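/- Let $d,T\ge 1$. Write $x=(x_1,\dots,x_T)\in\mathbb{R}^{dT}$ with $x_t\in\mathbb{R}^d$ and $x_{1:t}=(x_1,\dots,x_t)$, and equip $\mathbb{R}^{dt}$ with the norm $\|x\|=\sum_{s=1}^t\|x_s\|$, where $\|x_s\|$ is the Euclidean norm on $\mathbb{R}^d$. For a Borel probability measure $\mu$ on $\mathbb{R}^{dT}$ let $\mu_{x_{1:t}}$ denote the regular conditional distribution under $\mu$ of $x_{t+1}$ given $x_{1:t}$; for a probability measure $\pi$ on $\mathbb{R}^{dT}\times\mathbb{R}^{dT}$ let $\pi_{x_{1:t},y_{1:t}}$ denote the regular conditional distribution under $\pi$ of $(x_{t+1},y_{t+1})$ given $(x_{1:t},y_{1:t})$. Let $\mathrm{Cpl}(\mu,\nu)$ be the set of couplings of $\mu$ and $\nu$, let $\mathrm{Cpl}_{\mathrm{bc}}(\mu,\nu)$ be the set of those $\pi\in\mathrm{Cpl}(\mu,\nu)$ such that for all $t=1,\dots,T-1$, $\pi_{x_{1:t},y_{1:t}}\in\mathrm{Cpl}(\mu_{x_{1:t}},\nu_{y_{1:t}})$ for $\pi$-almost every $(x,y)$,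 and set $$\mathcal{W}_1(\mu,\nu)=\inf_{\pi\in\mathrm{Cpl}(\mu,\nu)}\int\|x-y\|\,\pi(dx,dy),\qquad \mathcal{AW}_1(\mu,\nu)=\inf_{\pi\in\mathrm{Cpl}_{\mathrm{bc}}(\mu,\nu)}\int\|x-y\|\,\pi(dx,dy).$$ Let $\mathcal{P}_1(\mathbb{R}^{dT})$ be the set of Borel probability measures on $\mathbb{R}^{dT}$ with finite first moment, and let $\mathcal{N}_\sigma=\mathcal{N}(0,\sigma^2 I_{dT})$. For $L>0$, say that $\mu\in\mathcal{P}_1(\mathbb{R}^{dT})$ has $L$-Lipschitz kernels if it admits a disintegration such that for all $t=1,\dots,T-1$, $\mathcal{W}_1(\mu_{x_{1:t}},\mu_{y_{1:t}})\le L\|x_{1:t}-y_{1:t}\|$ for all $x_{1:t},y_{1:t}\in\mathbb{R}^{dt}$. **Theorem (Lipschitz stability).** For every $L>0$ there exists a constant $\tilde C_L>0$, depending only on $L$, $d$ and $T$, such that for every $\mu\in\mathcal{P}_1(\mathbb{R}^{dT})$ with $L$-Lipschitz kernels and every $\sigma>0$, $$\mathcal{AW}_1(\mu,\mu*\mathcal{N}_\sigma)\le\tilde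 C_L\,\sigma.$$ -/

import Mathlib

open MeasureTheory ProbabilityTheory
open scoped ENNReal

namespace AdaptedTransport

/-- The state space `ℝ^d` with its Euclidean norm. -/
abbrev State (d : ℕ) : Type := EuclideanSpace ℝ (Fin d)

/-- The path space `ℝ^{dT}`: a path `x = (x_1, …, x_T)` of states. Time is indexed from zero, so
`x s` is the state written `x_{s+1}` on paper. The norm used on it is `sumDist` below. -/
abbrev Path (d T : ℕ) : Type := Fin T → State d

/-- `‖x - y‖ = ∑ s, ‖x_s - y_s‖`, the distance of the sum-norm on `ℝ^{dt}`. -/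
noncomputable def sumDist {d t : ℕ} (x y : Path d t) : ℝ := ∑ s, ‖x s - y s‖

/-- The initial segment `x_{1:t}`, which consists of the first `t` states of a path. -/
def initial {d T : ℕ} (t : Fin T) (x : Path d T) : Path d (t : ℕ) :=
  fun s => x (Fin.castLE t.is_lt.le s)

/-- `π ∈ Cpl(μ, ν)`: the first marginal of `π` is `μ` and the second is `ν`. -/
def IsCoupling {X : Type*} [MeasurableSpace X] (π : Measure (X × X)) (μ ν : Measure X) : Prop :=
  π.map Prod.fst = μ ∧ π.map Prod.snd = ν

/-- The first order Wasserstein distance on `ℝ^d`, as an extended nonnegative real. -/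
noncomputable def W₁ {d : ℕ} (μ ν : Measure (State d)) : ℝ≥0∞ :=
  ⨅ (π : Measure (State d × State d)) (_ : IsCoupling π μ ν),
    ∫⁻ p, ENNReal.ofReal ‖p.1 - p.2‖ ∂π

/-- `κ` is a version of the kernel `x_{1:t} ↦ μ_{x_{1:t}}`: a Markov kernel which is a regular
conditional distribution of the next state (`x t`, that is `x_{t+1}` on paper) given `x_{1:t}`. -/
def IsPathKernel {d T : ℕ} (μ : Measure (Path d T)) (t : Fin T)
    (κ : Kernel (Path d (t : ℕ)) (State d)) : Prop :=
  IsMarkovKernel κ ∧ HasCondDistrib (fun x => x t) (initial t) κ μ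

/-- `κ` is a version of the kernel `(x_{1:t}, y_{1:t}) ↦ π_{x_{1:t}, y_{1:t}}`: a Markov kernel
which is a regular conditional distribution of the next pair of states given both initial
segments. -/
def IsPairKernel {d T : ℕ} (π : Measure (Path d T × Path d T)) (t : Fin T)
    (κ : Kernel (Path d (t : ℕ) × Path d (t : ℕ)) (State d × State d)) : Prop :=
  IsMarkovKernel κ ∧
    HasCondDistrib (fun p => (p.1 t, p.2 t)) (fun p => (initial t p.1, initial t p.2)) κ π

/-- `π ∈ Cpl_bc(μ, ν)`: `π` is a coupling of `μ` and `ν` and, at every time,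
`π_{x_{1:t}, y_{1:t}} ∈ Cpl(μ_{x_{1:t}}, ν_{y_{1:t}})` for `π`-almost every `(x, y)`. As kernels are
unique up to null sets, the choice of the versions is immaterial. For the index `t = 0` the segments
are empty, and the condition is the automatic one that the law of `(x_1, y_1)` couples those of
`x_1` and `y_1`. -/
def IsBicausalCoupling {d T : ℕ} (π : Measure (Path d T × Path d T)) (μ ν : Measure (Path d T)) :
    Prop :=
  IsCoupling π μ ν ∧
    ∀ t : Fin T,
      ∃ (κμ κν : Kernel (Path d (t : ℕ)) (State d))
        (κπ : Kernel (Path d (t : ℕ) × Path d (t : ℕ)) (State d × State d)),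
        IsPathKernel μ t κμ ∧ IsPathKernel ν t κν ∧ IsPairKernel π t κπ ∧
        ∀ᵐ p ∂π, IsCoupling (κπ (initial t p.1, initial t p.2))
          (κμ (initial t p.1)) (κν (initial t p.2))

/-- The first order adapted Wasserstein distance, as an extended nonnegative real. -/
noncomputable def AW₁ {d T : ℕ} (μ ν : Measure (Path d T)) : ℝ≥0∞ :=
  ⨅ (π : Measure (Path d T × Path d T)) (_ : IsBicausalCoupling π μ ν),
    ∫⁻ p, ENNReal.ofReal (sumDist p.1 p.2) ∂π

/-- `μ` has a finite first moment. -/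
def FiniteFirstMoment {d T : ℕ} (μ : Measure (Path d T)) : Prop :=
  Integrable (fun x => sumDist x 0) μ

/-- `μ` has `L`-Lipschitz kernels: it admits a disintegration such that, at every time,
`x_{1:t} ↦ μ_{x_{1:t}}` is `L`-Lipschitz from the sum-norm to `W₁`. (For the index `t = 0` there is
only one, empty, segment, and nothing is required.) -/
def HasLipschitzKernels {d T : ℕ} (L : ℝ) (μ : Measure (Path d T)) : Prop :=
  ∀ t : Fin T, ∃ κ : Kernel (Path d (t : ℕ)) (State d), IsPathKernel μ t κ ∧
    ∀ x y : Path d (t : ℕ), W₁ (κ x) (κ y) ≤ ENNReal.ofReal (L * sumDist x y)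

/-- The Gaussian measure `N_σ = N(0, σ² I_{dT})` on the path space: the states are independent, and
each is distributed as `σ Z` with `Z` standard Gaussian on `ℝ^d`. -/
noncomputable def gaussianNoise (d T : ℕ) (σ : ℝ) : Measure (Path d T) :=
  Measure.pi fun _ => (stdGaussian (State d)).map fun z => σ • z

end AdaptedTransport

namespace AdaptedTransport

/-! ### Couplings of discrete weights -/

/-! The obvious coupling of `x` with `x + g` is in general not bicausal: given both pasts, the next
state of the noisy path still depends on the clean past hidden in it. The remedy is to resample that
past. The kernel of `μ * N_σ` at `y` draws `x` from the posterior law given `x + g = y`, moves from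
`x` by the kernel of `μ` and adds fresh noise (`noisyKernel`, `map_add_compProd_prod`). At a pair
`(x', y)`, with `x'` the clean past actually coupled to `y`, one draws such an `x` from `y` alone,
couples the kernels at `x'` and `x` at cost `L‖x' - x‖ + ε`, and adds noise to the second state
(`noisyCoupling`). The marginals are the kernels at `x'` and at `y`, so these one-step couplings
glue to a bicausal coupling (`isBicausalCoupling_pathLaw`).

For the cost, `‖x' - x‖ ≤ ‖x' - y‖ + ‖y - x‖`. The first term is the cost so far. In the second, `y`
has the law of `x + g`, so averaging the posterior returns the joint law of `(x + g, x)`, and the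
term contributes exactly the mean size of the noise. With `ε = σ` the costs obey a linear recursion
whose source terms are multiples of `σ`. Regularity of the kernels of the convolution is never
needed.

The couplings of the kernels at `x'` and `x` must depend measurably on `(x', x)`.
`exists_kernel_isCoupling` achieves this without a selection theorem: after quantizing the space,
countably many rational subcouplings suffice as candidates, the first one that works is completed to
a discrete coupling, and this is spread over the cells so that the marginals are exact. -/

lemma exists_rat_le_sub_mul_le {x h ε : ℝ≥0∞} (hx : x ≠ ∞) (hh : h ≠ ∞) (hε : ε ≠ 0) :
    ∃ q : ℚ, ENNReal.ofReal q ≤ x ∧ (x - ENNReal.ofReal q) * h ≤ ε := by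
  rcases eq_or_ne x 0 with rfl | hx0
  · exact ⟨0, by simp, by simp⟩
  have hη : ε / (h + 1) ≠ 0 := by
    simp [ENNReal.div_eq_zero_iff, hε, hh]
  obtain ⟨q, -, hq, hqx⟩ := ENNReal.lt_iff_exists_rat_btwn.1 (ENNReal.sub_lt_self hx hx0 hη)
  refine ⟨q, hqx.le, ?_⟩
  have h1 : x - ENNReal.ofReal q ≤ ε / (h + 1) :=
    tsub_le_iff_left.2 (tsub_le_iff_right.1 hq.le)
  calc (x - ENNReal.ofReal q) * h ≤ ε / (h + 1) * (h + 1) := by gcongr; exact le_self_add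
    _ = ε := ENNReal.div_mul_cancel (by simp) (by simpa using hh)

/-- Summable weights are approximated from below, in weighted `ℓ¹`, by rational weights of finite
support. -/
lemma exists_finsupp_rat_le_tsum_sub_mul_le {ι : Type*} [Countable ι] {ρ h : ι → ℝ≥0∞} {ε : ℝ≥0∞}
    (hρ : ∀ i, ρ i ≠ ∞) (hh : ∀ i, h i ≠ ∞) (hρh : ∑' i, ρ i * h i ≠ ∞) (hε : ε ≠ 0) :
    ∃ r : ι →₀ ℚ, (∀ i, ENNReal.ofReal (r i) ≤ ρ i) ∧
      ∑' i, (ρ i - ENNReal.ofReal (r i)) * h i ≤ ε := by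
  classical
  have hε2 : ε / 2 ≠ 0 := by simpa using hε
  -- Half of `ε` pays for rounding the weights in a finite set, the other half for discarding the
  -- tail.
  obtain ⟨δ, hδ, hδε⟩ := ENNReal.exists_pos_sum_of_countable' hε2 ι
  choose q hq hqδ using fun i => exists_rat_le_sub_mul_le (hρ i) (hh i) (hδ i).ne'
  obtain ⟨s, hs⟩ := ((tendsto_order.1 (ENNReal.tendsto_tsum_compl_atTop_zero hρh)).2 _
    (pos_iff_ne_zero.2 hε2)).exists
  refine ⟨Finsupp.onFinset s (fun i => if i ∈ s then q i else 0) (by simp +contextual),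
    fun i => ?_, ?_⟩
  · by_cases hi : i ∈ s <;> simp [hi, hq]
  · calc _ ≤ ∑' i, (δ i + Set.indicator {i | i ∉ s} (fun i => ρ i * h i) i) := by
          refine ENNReal.tsum_le_tsum fun i => ?_
          by_cases hi : i ∈ s <;> simp [hi, hqδ]
      _ = ∑' i, δ i + ∑' i : {i // i ∉ s}, ρ i * h i := by
          rw [ENNReal.tsum_add, ← tsum_subtype]; rfl
      _ ≤ ε / 2 + ε / 2 := by gcongr
      _ = ε := ENNReal.add_halves ε

/-- Complete a subcoupling `r` of the weights `p` and `q` to a coupling, by adding a multiple of the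
product of the missing parts of the marginals. -/
noncomputable def fillCoupling (p q : ℕ → ℝ≥0∞) (r : ℕ → ℕ → ℝ≥0∞) (i j : ℕ) : ℝ≥0∞ :=
  r i j + (p i - ∑' j, r i j) * (q j - ∑' i, r i j) / ∑' i, (p i - ∑' j, r i j)

section fillCoupling

variable {p q : ℕ → ℝ≥0∞} {r : ℕ → ℕ → ℝ≥0∞}

lemma tsum_deficit_fst_eq_one_sub (hp : ∑' i, p i = 1) (hr : ∀ i, ∑' j, r i j ≤ p i) :
    ∑' i, (p i - ∑' j, r i j) = 1 - ∑' i, ∑' j, r i j := by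
  rw [ENNReal.tsum_sub _ hr, hp]
  exact ne_top_of_le_ne_top ENNReal.one_ne_top (hp ▸ ENNReal.tsum_le_tsum hr)

/-- Both deficits are one minus the total mass of `r`, so a single normalization in `fillCoupling`
serves both marginals. -/
lemma tsum_deficit_snd_eq_fst (hp : ∑' i, p i = 1) (hq : ∑' j, q j = 1)
    (hr : ∀ i, ∑' j, r i j ≤ p i) (hr' : ∀ j, ∑' i, r i j ≤ q j) :
    ∑' j, (q j - ∑' i, r i j) = ∑' i, (p i - ∑' j, r i j) := by
  rw [tsum_deficit_fst_eq_one_sub hp hr,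
    tsum_deficit_fst_eq_one_sub (r := fun j i => r i j) hq hr', ENNReal.tsum_comm]

lemma tsum_deficit_ne_top (hp : ∑' i, p i = 1) (hr : ∀ i, ∑' j, r i j ≤ p i) :
    ∑' i, (p i - ∑' j, r i j) ≠ ∞ := by
  rw [tsum_deficit_fst_eq_one_sub hp hr]
  exact ne_top_of_le_ne_top ENNReal.one_ne_top tsub_le_self

/-- The bound `x ≤ y` covers `y = 0`, which in `fillCoupling` is the case where `r` is already a
coupling. -/
lemma mul_div_cancel_of_le {x y : ℝ≥0∞} (hy : y ≠ ∞) (hxy : x ≤ y) : x * y / y = x := by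
  rcases eq_or_ne y 0 with rfl | h
  · simp [nonpos_iff_eq_zero.1 hxy]
  · exact ENNReal.mul_div_cancel_right h hy

lemma tsum_fillCoupling_fst (hp : ∑' i, p i = 1) (hq : ∑' j, q j = 1)
    (hr : ∀ i, ∑' j, r i j ≤ p i) (hr' : ∀ j, ∑' i, r i j ≤ q j) (i : ℕ) :
    ∑' j, fillCoupling p q r i j = p i := by
  simp only [fillCoupling, ENNReal.tsum_add, div_eq_mul_inv, ENNReal.tsum_mul_right,
    ENNReal.tsum_mul_left, tsum_deficit_snd_eq_fst hp hq hr hr']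
  rw [← div_eq_mul_inv, mul_div_cancel_of_le (tsum_deficit_ne_top hp hr) (ENNReal.le_tsum i),
    add_tsub_cancel_of_le (hr i)]

lemma tsum_fillCoupling_snd (hp : ∑' i, p i = 1) (hq : ∑' j, q j = 1)
    (hr : ∀ i, ∑' j, r i j ≤ p i) (hr' : ∀ j, ∑' i, r i j ≤ q j) (j : ℕ) :
    ∑' i, fillCoupling p q r i j = q j := by
  rw [← tsum_fillCoupling_fst (r := fun j i => r i j) hq hp hr' hr j]
  refine tsum_congr fun i => ?_
  simp only [fillCoupling, tsum_deficit_snd_eq_fst hp hq hr hr', mul_comm]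

/-- The added part has the two deficits as its marginals, so the separable bound on `D` prices it by
the deficits alone. -/
lemma tsum_fillCoupling_mul_le (hp : ∑' i, p i = 1) (hq : ∑' j, q j = 1)
    (hr : ∀ i, ∑' j, r i j ≤ p i) (hr' : ∀ j, ∑' i, r i j ≤ q j)
    {D : ℕ → ℕ → ℝ≥0∞} {h : ℕ → ℝ≥0∞} (hD : ∀ i j, D i j ≤ h i + h j) :
    ∑' i, ∑' j, fillCoupling p q r i j * D i j ≤ ∑' i, ∑' j, r i j * D i j +
      (∑' i, (p i - ∑' j, r i j) * h i + ∑' j, (q j - ∑' i, r i j) * h j) := by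
  set M := ∑' i, (p i - ∑' j, r i j) with hM
  have hM' := tsum_deficit_snd_eq_fst hp hq hr hr'
  simp only [fillCoupling, add_mul, ENNReal.tsum_add]
  refine add_le_add le_rfl ?_
  calc _ ≤ ∑' i, ∑' j, ((p i - ∑' j, r i j) * h i * (q j - ∑' i, r i j) * M⁻¹
            + (p i - ∑' j, r i j) * ((q j - ∑' i, r i j) * h j) * M⁻¹) := by
        refine ENNReal.tsum_le_tsum fun i => ENNReal.tsum_le_tsum fun j => ?_
        grw [hD i j]
        rw [div_eq_mul_inv]
        exact le_of_eq (by ring)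
    _ = (∑' i, (p i - ∑' j, r i j) * h i) * (M / M)
          + (∑' j, (q j - ∑' i, r i j) * h j) * (M / M) := by
        simp only [ENNReal.tsum_add, ENNReal.tsum_mul_right, ENNReal.tsum_mul_left, hM', ← hM,
          div_eq_mul_inv]
        ring
    _ ≤ _ := by
        grw [ENNReal.div_self_le_one, mul_one, mul_one]

end fillCoupling

/-- Couplings of discrete weights that depend measurably on a parameter can be chosen measurably,
at an arbitrarily small additional cost. -/
lemma exists_measurable_discrete_coupling {A : Type*} [MeasurableSpace A] {p q : A → ℕ → ℝ≥0∞}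
    {D : ℕ → ℕ → ℝ≥0∞} {h : ℕ → ℝ≥0∞} {c : A → ℝ≥0∞} {ε : ℝ≥0∞}
    (hpm : ∀ i, Measurable fun a => p a i) (hqm : ∀ i, Measurable fun a => q a i)
    (hp : ∀ a, ∑' i, p a i = 1) (hq : ∀ a, ∑' i, q a i = 1)
    (hD : ∀ i j, D i j ≤ h i + h j) (hh : ∀ i, h i ≠ ∞)
    (hph : ∀ a, ∑' i, p a i * h i ≠ ∞) (hqh : ∀ a, ∑' i, q a i * h i ≠ ∞)
    (hc : Measurable c)
    (H : ∀ a, ∃ ρ : ℕ → ℕ → ℝ≥0∞, (∀ i, ∑' j, ρ i j = p a i) ∧ (∀ j, ∑' i, ρ i j = q a j) ∧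
      ∑' i, ∑' j, ρ i j * D i j ≤ c a) (hε : ε ≠ 0) :
    ∃ w : A → ℕ → ℕ → ℝ≥0∞, (∀ i j, Measurable fun a => w a i j) ∧
      (∀ a i, ∑' j, w a i j = p a i) ∧ (∀ a j, ∑' i, w a i j = q a j) ∧
      ∀ a, ∑' i, ∑' j, w a i j * D i j ≤ c a + ε := by
  classical
  -- The candidates, independent of `a`, are countably many finitely supported rational matrices; `P
  -- a n` says that the `n`-th is a subcoupling at `a` whose completion is cheap enough.
  obtain ⟨e, he⟩ := exists_surjective_nat (ℕ × ℕ →₀ ℚ)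
  let R : ℕ → ℕ → ℕ → ℝ≥0∞ := fun n i j => ENNReal.ofReal (e n (i, j))
  let P : A → ℕ → Prop := fun a n => (∀ i, ∑' j, R n i j ≤ p a i) ∧ (∀ j, ∑' i, R n i j ≤ q a j) ∧
    ∑' i, ∑' j, fillCoupling (p a) (q a) (R n) i j * D i j ≤ c a + ε
  have hfill : ∀ n i j, Measurable fun a => fillCoupling (p a) (q a) (R n) i j := fun n i j => by
    unfold fillCoupling
    fun_prop
  have hP : ∀ a, ∃ n, P a n := fun a => by
    obtain ⟨ρ, hρ1, hρ2, hρc⟩ := H a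
    have hρ : ∀ i j, ρ i j ≠ ∞ := fun i j => by
      refine ne_top_of_le_ne_top ENNReal.one_ne_top ?_
      calc ρ i j ≤ ∑' j, ρ i j := ENNReal.le_tsum j
        _ = p a i := hρ1 i
        _ ≤ ∑' i, p a i := ENNReal.le_tsum i
        _ = 1 := hp a
    have hmom : ∑' x : ℕ × ℕ, ρ x.1 x.2 * (h x.1 + h x.2) ≠ ∞ := by
      have : ∑' x : ℕ × ℕ, ρ x.1 x.2 * (h x.1 + h x.2)
          = ∑' i, p a i * h i + ∑' j, q a j * h j := by
        simp only [mul_add, ENNReal.tsum_add]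
        congr 1
        · rw [ENNReal.tsum_prod (f := fun i j => ρ i j * h i)]
          simp only [ENNReal.tsum_mul_right, hρ1]
        · rw [ENNReal.tsum_prod (f := fun i j => ρ i j * h j), ENNReal.tsum_comm]
          simp only [ENNReal.tsum_mul_right, hρ2]
      rw [this]
      exact ENNReal.add_ne_top.2 ⟨hph a, hqh a⟩
    obtain ⟨r, hr, hrε⟩ := exists_finsupp_rat_le_tsum_sub_mul_le (fun x : ℕ × ℕ => hρ x.1 x.2)
      (fun x => ENNReal.add_ne_top.2 ⟨hh x.1, hh x.2⟩) hmom hε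
    obtain ⟨n, rfl⟩ := he r
    have hR : ∀ i j, R n i j ≤ ρ i j := fun i j => hr (i, j)
    have h1 : ∀ i, ∑' j, R n i j ≤ p a i := fun i =>
      (ENNReal.tsum_le_tsum (hR i)).trans (hρ1 i).le
    have h2 : ∀ j, ∑' i, R n i j ≤ q a j := fun j =>
      (ENNReal.tsum_le_tsum fun i => hR i j).trans (hρ2 j).le
    -- The deficits are the row and column sums of the rounding error, which was made small against
    -- the weight `h i + h j` for this purpose.
    have d1 : ∀ i, p a i - ∑' j, R n i j = ∑' j, (ρ i j - R n i j) := fun i => by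
      rw [← hρ1 i]
      refine (ENNReal.tsum_sub (ne_top_of_le_ne_top ?_ (h1 i)) (hR i)).symm
      exact ne_top_of_le_ne_top ENNReal.one_ne_top (hp a ▸ ENNReal.le_tsum i)
    have d2 : ∀ j, q a j - ∑' i, R n i j = ∑' i, (ρ i j - R n i j) := fun j => by
      rw [← hρ2 j]
      refine (ENNReal.tsum_sub (ne_top_of_le_ne_top ?_ (h2 j)) fun i => hR i j).symm
      exact ne_top_of_le_ne_top ENNReal.one_ne_top (hq a ▸ ENNReal.le_tsum j)
    refine ⟨n, h1, h2, (tsum_fillCoupling_mul_le (hp a) (hq a) h1 h2 hD).trans ?_⟩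
    gcongr
    · refine le_trans ?_ hρc
      gcongr
      exact hR _ _
    · refine le_trans (le_of_eq ?_) hrε
      rw [ENNReal.tsum_prod (f := fun i j => (ρ i j - R n i j) * (h i + h j))]
      simp only [mul_add, ENNReal.tsum_add, d1, d2, ENNReal.tsum_mul_right]
      congr 1
      rw [ENNReal.tsum_comm]
      simp only [ENNReal.tsum_mul_right]
  have hPm : ∀ n, MeasurableSet {a | P a n} := fun n => by
    simp only [P, Set.ofPred_and, Set.ofPred_forall]
    refine (MeasurableSet.iInter fun i => measurableSet_le measurable_const (hpm i)).inter
      ((MeasurableSet.iInter fun i => measurableSet_le measurable_const (hqm i)).inter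
        (measurableSet_le ?_ (by fun_prop)))
    fun_prop
  -- Taking the first admissible candidate keeps the choice measurable.
  refine ⟨fun a => fillCoupling (p a) (q a) (R (Nat.find (hP a))),
    fun i j => Measurable.find (f := fun n a => fillCoupling (p a) (q a) (R n) i j)
      (p := fun n a => P a n) (fun n => hfill n i j) hPm hP, ?_, ?_, ?_⟩
  · intro a
    obtain ⟨h1, h2, -⟩ := Nat.find_spec (hP a)
    exact tsum_fillCoupling_fst (hp a) (hq a) h1 h2
  · intro a
    obtain ⟨h1, h2, -⟩ := Nat.find_spec (hP a)
    exact tsum_fillCoupling_snd (hp a) (hq a) h1 h2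
  · exact fun a => (Nat.find_spec (hP a)).2.2

/-! ### Measurable choice of almost optimal couplings -/

lemma lintegral_comp_nat {E : Type*} [MeasurableSpace E] (m : Measure E) {Q : E → ℕ}
    (hQ : Measurable Q) (f : ℕ → ℝ≥0∞) :
    ∫⁻ z, f (Q z) ∂m = ∑' i, f i * m (Q ⁻¹' {i}) := by
  rw [← lintegral_map (f := f) (by fun_prop) hQ, lintegral_countable']
  simp only [Measure.map_apply hQ (measurableSet_singleton _)]

lemma tsum_measure_inter_preimage_nat {E : Type*} [MeasurableSpace E] (m : Measure E) {Q : E → ℕ}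
    (hQ : Measurable Q) (s : Set E) :
    ∑' i, m (s ∩ Q ⁻¹' {i}) = m s := by
  have h := lintegral_comp_nat (m.restrict s) hQ 1
  simp only [Pi.one_apply, lintegral_const, one_mul, Measure.restrict_apply MeasurableSet.univ,
    Measure.restrict_apply (hQ (measurableSet_singleton _)), Set.univ_inter] at h
  rw [h]
  exact tsum_congr fun i => by rw [Set.inter_comm]

/-- `blockDensity` is normalized only over cells of positive mass; almost every point lies in one.
-/
lemma ae_measure_fiber_ne_zero {E : Type*} [MeasurableSpace E] (m : Measure E) {Q : E → ℕ}
    (hQ : Measurable Q) : ∀ᵐ z ∂m, m (Q ⁻¹' {Q z}) ≠ 0 := by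
  refine ae_of_ae_map (p := fun i => m (Q ⁻¹' {i}) ≠ 0) hQ.aemeasurable
    (ae_iff_of_countable.2 fun i hi => ?_)
  rwa [Measure.map_apply hQ (measurableSet_singleton _)] at hi

/-- The density, with respect to the product measure, of the coupling which distributes the
discrete coupling `w` proportionally. -/
noncomputable def blockDensity (p q : ℕ → ℝ≥0∞) (w : ℕ → ℕ → ℝ≥0∞) (i j : ℕ) : ℝ≥0∞ :=
  w i j / (p i * q j)

section block

variable {E : Type*} [MeasurableSpace E] {p q : ℕ → ℝ≥0∞} {w : ℕ → ℕ → ℝ≥0∞}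

lemma tsum_blockDensity_mul (hp : ∀ i, p i ≠ ∞) (hq : ∀ j, q j ≠ ∞)
    (hw : ∀ i, ∑' j, w i j = p i) (hw' : ∀ j, ∑' i, w i j = q j) {i : ℕ} (hi : p i ≠ 0) :
    ∑' j, blockDensity p q w i j * q j = 1 := by
  have h : ∀ j, blockDensity p q w i j * q j = w i j * (p i)⁻¹ := fun j => by
    -- On a null cell the weights `w` vanish with their marginal, so the division by zero loses no
    -- mass.
    rcases eq_or_ne (q j) 0 with hj | hj
    · have : w i j = 0 := by
        have := hw' j ▸ ENNReal.le_tsum (f := fun i => w i j) i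
        simpa [hj] using this
      simp [this, hj]
    · rw [blockDensity, div_eq_mul_inv, ENNReal.mul_inv (Or.inl hi) (Or.inl (hp i)), mul_assoc,
        mul_assoc, ENNReal.inv_mul_cancel hj (hq j), mul_one]
  simp only [h, ENNReal.tsum_mul_right, hw, ENNReal.mul_inv_cancel hi (hp i)]

lemma blockDensity_swap (i j : ℕ) :
    blockDensity p q w i j = blockDensity q p (fun j i => w i j) j i := by
  simp [blockDensity, mul_comm]

variable {m m' : Measure E} {Q : E → ℕ}

lemma measurable_blockDensity_comp (hQ : Measurable Q) :
    Measurable fun z : E × E => blockDensity p q w (Q z.1) (Q z.2) :=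
  (measurable_of_countable fun x : ℕ × ℕ => blockDensity p q w x.1 x.2).comp
    (f := fun z : E × E => (Q z.1, Q z.2))
    ((hQ.comp measurable_fst).prodMk (hQ.comp measurable_snd))

/-- The density is constant on products of cells, so integrating out one coordinate gives a sum over
cells, which equals one. Thus the marginals are `m` and `m'` themselves, not their quantizations. -/
lemma isCoupling_withDensity_blockDensity [IsProbabilityMeasure m] [IsProbabilityMeasure m']
    (hQ : Measurable Q)
    (hw : ∀ i, ∑' j, w i j = m (Q ⁻¹' {i})) (hw' : ∀ j, ∑' i, w i j = m' (Q ⁻¹' {j})) :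
    IsCoupling ((m.prod m').withDensity fun z =>
      blockDensity (fun i => m (Q ⁻¹' {i})) (fun j => m' (Q ⁻¹' {j})) w (Q z.1) (Q z.2)) m m' := by
  have hf := measurable_blockDensity_comp (p := fun i => m (Q ⁻¹' {i}))
    (q := fun j => m' (Q ⁻¹' {j})) (w := w) hQ
  constructor
  · ext B hB
    rw [Measure.map_apply measurable_fst hB, withDensity_apply _ (measurable_fst hB),
      ← lintegral_indicator (measurable_fst hB),
      lintegral_prod _ (hf.indicator (measurable_fst hB)).aemeasurable,
      ← lintegral_indicator_one hB]
    refine lintegral_congr_ae ?_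
    filter_upwards [ae_measure_fiber_ne_zero m hQ] with z hz
    by_cases hzB : z ∈ B
    · simp only [Set.indicator, Set.mem_preimage, hzB, if_true, Pi.one_apply]
      rw [lintegral_comp_nat m' hQ (blockDensity _ _ w (Q z))]
      exact tsum_blockDensity_mul (by simp) (by simp) hw hw' hz
    · simp [Set.indicator, hzB]
  · ext B hB
    rw [Measure.map_apply measurable_snd hB, withDensity_apply _ (measurable_snd hB),
      ← lintegral_indicator (measurable_snd hB),
      lintegral_prod_symm _ (hf.indicator (measurable_snd hB)).aemeasurable,
      ← lintegral_indicator_one hB]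
    refine lintegral_congr_ae ?_
    filter_upwards [ae_measure_fiber_ne_zero m' hQ] with z hz
    by_cases hzB : z ∈ B
    · simp only [Set.indicator, Set.mem_preimage, hzB, if_true, Pi.one_apply]
      simp only [blockDensity_swap (Q _) (Q z)]
      rw [lintegral_comp_nat m hQ (blockDensity _ _ (fun j i => w i j) (Q z))]
      exact tsum_blockDensity_mul (by simp) (by simp) hw' hw hz
    · simp [Set.indicator, hzB]

/-- Only an inequality, since nothing is assumed of `w` on pairs of cells of zero product mass. -/
lemma lintegral_withDensity_blockDensity_le [SFinite m'] (hQ : Measurable Q) (D : ℕ → ℕ → ℝ≥0∞) :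
    ∫⁻ z, D (Q z.1) (Q z.2) ∂((m.prod m').withDensity fun z =>
      blockDensity (fun i => m (Q ⁻¹' {i})) (fun j => m' (Q ⁻¹' {j})) w (Q z.1) (Q z.2))
      ≤ ∑' i, ∑' j, w i j * D i j := by
  have hf := measurable_blockDensity_comp (p := fun i => m (Q ⁻¹' {i}))
    (q := fun j => m' (Q ⁻¹' {j})) (w := w) hQ
  have hD : Measurable fun z : E × E => D (Q z.1) (Q z.2) :=
    (measurable_of_countable fun x : ℕ × ℕ => D x.1 x.2).comp
      (f := fun z : E × E => (Q z.1, Q z.2))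
    ((hQ.comp measurable_fst).prodMk (hQ.comp measurable_snd))
  rw [lintegral_withDensity_eq_lintegral_mul _ hf hD, lintegral_prod _ (hf.mul hD).aemeasurable]
  simp only [Pi.mul_apply]
  have h1 : ∀ z, ∫⁻ z', blockDensity (fun i => m (Q ⁻¹' {i})) (fun j => m' (Q ⁻¹' {j})) w
      (Q z) (Q z') * D (Q z) (Q z') ∂m' = ∑' j, blockDensity (fun i => m (Q ⁻¹' {i}))
        (fun j => m' (Q ⁻¹' {j})) w (Q z) j * D (Q z) j * m' (Q ⁻¹' {j}) := fun z =>
    lintegral_comp_nat m' hQ fun j => blockDensity (fun i => m (Q ⁻¹' {i}))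
      (fun j => m' (Q ⁻¹' {j})) w (Q z) j * D (Q z) j
  simp only [h1]
  rw [lintegral_comp_nat m hQ fun i => ∑' j, blockDensity (fun i => m (Q ⁻¹' {i}))
        (fun j => m' (Q ⁻¹' {j})) w i j * D i j * m' (Q ⁻¹' {j})]
  refine ENNReal.tsum_le_tsum fun i => ?_
  rw [← ENNReal.tsum_mul_right]
  refine ENNReal.tsum_le_tsum fun j => ?_
  calc _ = (m (Q ⁻¹' {i}) * m' (Q ⁻¹' {j})) *
          (w i j / (m (Q ⁻¹' {i}) * m' (Q ⁻¹' {j}))) * D i j := by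
        rw [blockDensity]; ring
    _ ≤ _ := by grw [ENNReal.mul_div_le]

end block

lemma IsCoupling.lintegral_fst {E : Type*} [MeasurableSpace E] {ρ : Measure (E × E)}
    {m m' : Measure E} (h : IsCoupling ρ m m') {f : E → ℝ≥0∞} (hf : Measurable f) :
    ∫⁻ z, f z.1 ∂ρ = ∫⁻ z, f z ∂m := by
  rw [← h.1, lintegral_map hf measurable_fst]

lemma IsCoupling.lintegral_snd {E : Type*} [MeasurableSpace E] {ρ : Measure (E × E)}
    {m m' : Measure E} (h : IsCoupling ρ m m') {f : E → ℝ≥0∞} (hf : Measurable f) :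
    ∫⁻ z, f z.2 ∂ρ = ∫⁻ z, f z ∂m' := by
  rw [← h.2, lintegral_map hf measurable_snd]

lemma IsCoupling.isProbabilityMeasure {X : Type*} [MeasurableSpace X] {ρ : Measure (X × X)}
    {m m' : Measure X} [hm : IsProbabilityMeasure m] (h : IsCoupling ρ m m') :
    IsProbabilityMeasure ρ := by
  have := h.1 ▸ hm
  exact (Measure.isProbabilityMeasure_map_iff measurable_fst.aemeasurable).1 this

/-! ### Measurable couplings of kernels on a separable metric space -/

section metric

variable {E : Type*} [PseudoMetricSpace E] [SecondCountableTopology E] [MeasurableSpace E]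
  [BorelSpace E]

lemma exists_measurable_quantization [Nonempty E] {δ : ℝ≥0∞} (hδ : δ ≠ 0) :
    ∃ (Q : E → ℕ) (c : ℕ → E), Measurable Q ∧ ∀ z, edist z (c (Q z)) ≤ δ := by
  classical
  have h : ∀ z : E, ∃ n, edist z (TopologicalSpace.denseSeq E n) < δ := fun z => by
    obtain ⟨_, ⟨n, rfl⟩, hn⟩ := EMetric.mem_closure_iff.1
      (TopologicalSpace.denseRange_denseSeq E z) δ (pos_iff_ne_zero.2 hδ)
    exact ⟨n, hn⟩
  refine ⟨fun z => Nat.find (h z), TopologicalSpace.denseSeq E, measurable_find h fun n => ?_,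
    fun z => (Nat.find_spec (h z)).le⟩
  exact measurableSet_lt (by fun_prop) measurable_const

/-- If the values of two Markov kernels have couplings of cost at most `c`, where `c` is measurable,
then they can be coupled by a Markov kernel of cost at most `c + ε`. -/
theorem exists_kernel_isCoupling {A : Type*} [MeasurableSpace A] (κ κ' : Kernel A E)
    [IsMarkovKernel κ] [IsMarkovKernel κ'] (x₀ : E)
    (hκ : ∀ a, ∫⁻ z, edist z x₀ ∂(κ a) ≠ ∞) (hκ' : ∀ a, ∫⁻ z, edist z x₀ ∂(κ' a) ≠ ∞)
    {c : A → ℝ≥0∞} (hc : Measurable c)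
    (H : ∀ a, ∃ ρ, IsCoupling ρ (κ a) (κ' a) ∧ ∫⁻ z, edist z.1 z.2 ∂ρ ≤ c a)
    {ε : ℝ≥0∞} (hε : ε ≠ 0) :
    ∃ γ : Kernel A (E × E), IsMarkovKernel γ ∧
      ∀ a, IsCoupling (γ a) (κ a) (κ' a) ∧ ∫⁻ z, edist z.1 z.2 ∂(γ a) ≤ c a + ε := by
  rcases eq_or_ne ε ∞ with rfl | hε'
  · exact ⟨κ ×ₖ κ', inferInstance, fun a => ⟨by simp [Kernel.prod_apply, IsCoupling,
      Measure.map_fst_prod, Measure.map_snd_prod], by simp⟩⟩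
  -- Two fifths pay for quantizing the given coupling, one for the discrete selection, two for
  -- returning from cell centres to points.
  have hδ : ε / 5 ≠ 0 := by simp [ENNReal.div_eq_zero_iff, hε]
  have hδ' : ε / 5 ≠ ∞ := (ENNReal.div_lt_top hε' (by norm_num)).ne
  have h5 : ε / 5 + ε / 5 + ε / 5 + ε / 5 + ε / 5 = ε := by
    calc _ = 5 * (ε / 5) := by ring
      _ = ε := ENNReal.mul_div_cancel (by norm_num) (by norm_num)
  set δ := ε / 5
  have : Nonempty E := ⟨x₀⟩
  obtain ⟨Q, y, hQ, hQy⟩ := exists_measurable_quantization (E := E) hδ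
  have hmom : ∀ (κ : Kernel A E) [IsMarkovKernel κ], (∀ a, ∫⁻ z, edist z x₀ ∂(κ a) ≠ ∞) →
      ∀ a, ∑' i, κ a (Q ⁻¹' {i}) * edist (y i) x₀ ≠ ∞ := by
    intro κ _ hκ a
    simp only [mul_comm (κ a _)]
    rw [← lintegral_comp_nat (κ a) hQ fun i => edist (y i) x₀]
    refine ne_top_of_le_ne_top (ENNReal.add_ne_top.2 ⟨hδ', hκ a⟩) ?_
    calc _ ≤ ∫⁻ z, (δ + edist z x₀) ∂(κ a) := by
          refine lintegral_mono fun z => (edist_triangle _ z _).trans ?_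
          gcongr
          rw [edist_comm]
          exact hQy z
      _ = _ := by simp [lintegral_add_left]
  have hsum : ∀ (κ : Kernel A E) [IsMarkovKernel κ] (a), ∑' i, κ a (Q ⁻¹' {i}) = 1 := by
    intro κ _ a
    simpa using tsum_measure_inter_preimage_nat (κ a) hQ Set.univ
  have hmeas : ∀ (κ : Kernel A E) (i), Measurable fun a => κ a (Q ⁻¹' {i}) := fun κ i =>
    κ.measurable_coe (hQ (measurableSet_singleton i))
  obtain ⟨w, hwm, hw, hw', hwD⟩ := exists_measurable_discrete_coupling
    (p := fun a i => κ a (Q ⁻¹' {i})) (q := fun a i => κ' a (Q ⁻¹' {i}))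
    (D := fun i j => edist (y i) (y j)) (h := fun i => edist (y i) x₀)
    (c := fun a => c a + (δ + δ)) (hmeas κ) (hmeas κ') (hsum κ) (hsum κ')
    (fun i j => edist_triangle_right _ _ _) (fun i => edist_ne_top _ _) (hmom κ hκ) (hmom κ' hκ')
    (by fun_prop) (fun a => by
      obtain ⟨ρ, hρ, hρc⟩ := H a
      have := hρ.isProbabilityMeasure
      -- The discrete competitor is the mass that the given coupling puts on each pair of cells.
      refine ⟨fun i j => ρ ((Prod.fst ⁻¹' (Q ⁻¹' {i})) ∩ (Q ∘ Prod.snd) ⁻¹' {j}), fun i => ?_,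
        fun j => ?_, ?_⟩
      · have hi := hQ (measurableSet_singleton i)
        rw [tsum_measure_inter_preimage_nat ρ (hQ.comp measurable_snd),
          ← Measure.map_apply measurable_fst hi, hρ.1]
      · have hj := hQ (measurableSet_singleton j)
        rw [← hρ.2, Measure.map_apply measurable_snd hj,
          ← tsum_measure_inter_preimage_nat ρ (hQ.comp measurable_fst)]
        exact tsum_congr fun i => by rw [Set.inter_comm]; rfl
      · calc _ = ∑' x : ℕ × ℕ, edist (y x.1) (y x.2) * ρ.map (Prod.map Q Q) {x} := by
              rw [ENNReal.tsum_prod (f := fun i j => edist (y i) (y j) *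
                ρ.map (Prod.map Q Q) {(i, j)})]
              refine tsum_congr fun i => tsum_congr fun j => ?_
              rw [Measure.map_apply (hQ.prodMap hQ) (measurableSet_singleton _), mul_comm]
              congr 1
              refine congrArg ρ ?_
              ext z
              simp [Prod.ext_iff]
          _ = ∫⁻ z, edist (y (Q z.1)) (y (Q z.2)) ∂ρ := by
              rw [← lintegral_countable' fun x : ℕ × ℕ => edist (y x.1) (y x.2),
                lintegral_map (measurable_of_countable _) (hQ.prodMap hQ)]
              rfl
          _ ≤ ∫⁻ z, (edist z.1 z.2 + (δ + δ)) ∂ρ := by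
              refine lintegral_mono fun z => ?_
              grw [edist_triangle4 (y (Q z.1)) z.1 z.2 (y (Q z.2)), hQy z.2,
                edist_comm (y (Q z.1)) z.1, hQy z.1]
              exact le_of_eq (by ring)
          _ = ∫⁻ z, edist z.1 z.2 ∂ρ + (δ + δ) := by simp [lintegral_add_right]
          _ ≤ _ := by gcongr) hδ
  let f : A → E × E → ℝ≥0∞ := fun a z => blockDensity (fun i => κ a (Q ⁻¹' {i}))
    (fun j => κ' a (Q ⁻¹' {j})) (w a) (Q z.1) (Q z.2)
  have hf : Measurable (Function.uncurry f) := by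
    have h : Measurable fun x : A × (ℕ × ℕ) => blockDensity (fun i => κ x.1 (Q ⁻¹' {i}))
        (fun j => κ' x.1 (Q ⁻¹' {j})) (w x.1) x.2.1 x.2.2 := by
      refine measurable_from_prod_countable_left fun x => ?_
      simp only [blockDensity]
      exact (hwm _ _).div ((hmeas κ _).mul (hmeas κ' _))
    exact h.comp (measurable_fst.prodMk ((hQ.comp (measurable_fst.comp measurable_snd)).prodMk
      (hQ.comp (measurable_snd.comp measurable_snd))))
  have hγ : ∀ a, (κ ×ₖ κ').withDensity f a = ((κ a).prod (κ' a)).withDensity (f a) := fun a => by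
    rw [Kernel.withDensity_apply _ hf, Kernel.prod_apply]
  have hcpl : ∀ a, IsCoupling ((κ ×ₖ κ').withDensity f a) (κ a) (κ' a) := fun a => by
    rw [hγ]
    exact isCoupling_withDensity_blockDensity hQ (hw a) (hw' a)
  have hprob : ∀ a, IsProbabilityMeasure ((κ ×ₖ κ').withDensity f a) := fun a =>
    (hcpl a).isProbabilityMeasure
  refine ⟨(κ ×ₖ κ').withDensity f, ⟨hprob⟩, fun a => ⟨hcpl a, ?_⟩⟩
  have := hprob a
  calc _ ≤ ∫⁻ z, (edist (y (Q z.1)) (y (Q z.2)) + (δ + δ)) ∂((κ ×ₖ κ').withDensity f a) := by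
        refine lintegral_mono fun z => ?_
        grw [edist_triangle4 z.1 (y (Q z.1)) (y (Q z.2)) z.2, hQy z.1, edist_comm (y (Q z.2)) z.2,
          hQy z.2]
        exact le_of_eq (by ring)
    _ = ∫⁻ z, edist (y (Q z.1)) (y (Q z.2)) ∂((κ ×ₖ κ').withDensity f a) + (δ + δ) := by
        simp [lintegral_add_right]
    _ ≤ c a + (δ + δ) + δ + (δ + δ) := by
        gcongr
        rw [hγ]
        exact (lintegral_withDensity_blockDensity_le hQ fun i j => edist (y i) (y j)).trans (hwD a)
    _ = c a + ε := by rw [← h5]; ring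

end metric

/-! ### Gluing kernels along time -/

variable {d T : ℕ}

@[fun_prop]
lemma measurable_initial (t : Fin T) : Measurable (initial (d := d) t) :=
  measurable_pi_lambda _ fun _ => measurable_pi_apply _

/-- Append a state to a path. -/
def append {n : ℕ} (z : Path d n × State d) : Path d (n + 1) :=
  Fin.snoc (α := fun _ => State d) z.1 z.2

@[simp]
lemma append_last {n : ℕ} (z : Path d n × State d) : append z (Fin.last n) = z.2 := by
  simp [append]

@[simp]
lemma append_castSucc {n : ℕ} (z : Path d n × State d) (s : Fin n) :
    append z s.castSucc = z.1 s := by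
  simp [append]

@[fun_prop]
lemma measurable_append {n : ℕ} : Measurable (append (d := d) (n := n)) := by
  refine measurable_pi_iff.2 fun s => ?_
  induction s using Fin.lastCases with
  | last => simpa using measurable_snd
  | cast s =>
    simp only [append_castSucc]
    fun_prop

@[simp]
lemma initial_last_append {n : ℕ} (z : Path d n × State d) :
    initial (Fin.last n) (append z) = z.1 :=
  funext fun s => append_castSucc z s

@[simp]
lemma initial_castSucc_append {n : ℕ} (z : Path d n × State d) (t : Fin n) :
    initial t.castSucc (append z) = initial t z.1 :=
  funext fun s => append_castSucc z (Fin.castLE t.is_lt.le s)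

/-- A law on the path space is determined by its kernels. -/
lemma eq_of_isPathKernel {μ μ' : Measure (Path d T)} [IsProbabilityMeasure μ]
    [IsProbabilityMeasure μ'] {κ : (t : Fin T) → Kernel (Path d (t : ℕ)) (State d)}
    (h : ∀ t, IsPathKernel μ t (κ t)) (h' : ∀ t, IsPathKernel μ' t (κ t)) : μ = μ' := by
  -- Induction on the length of the initial segment: each kernel extends the common law by one
  -- state.
  have key : ∀ (n : ℕ) (hn : n ≤ T), μ.map (fun x (s : Fin n) => x (Fin.castLE hn s))
      = μ'.map fun x (s : Fin n) => x (Fin.castLE hn s) := by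
    intro n
    induction n with
    | zero =>
      intro hn
      have hm : Measurable fun (x : Path d T) (s : Fin 0) => x (Fin.castLE hn s) := by fun_prop
      have := Measure.isProbabilityMeasure_map (μ := μ) hm.aemeasurable
      have := Measure.isProbabilityMeasure_map (μ := μ') hm.aemeasurable
      ext s hs
      rcases s.eq_empty_or_nonempty with rfl | hs
      · simp
      · rw [Set.Nonempty.eq_univ hs, measure_univ, measure_univ]
    | succ n ih =>
      intro hn
      have step : ∀ {μ : Measure (Path d T)}, IsPathKernel μ ⟨n, hn⟩ (κ ⟨n, hn⟩) →
          μ.map (fun x (s : Fin (n + 1)) => x (Fin.castLE hn s)) =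
          ((μ.map fun x (s : Fin n) => x (Fin.castLE (n.le_succ.trans hn) s)) ⊗ₘ
            κ ⟨n, hn⟩).map append := by
        intro μ hμ
        have hmap := hμ.2.map_eq
        change _ = (μ.map (initial (⟨n, hn⟩ : Fin T)) ⊗ₘ _).map _
        rw [← hmap, Measure.map_map measurable_append (by fun_prop)]
        congr 1
        ext1 x
        ext1 s
        induction s using Fin.lastCases with
        | last => exact (append_last (initial ⟨n, hn⟩ x, x ⟨n, hn⟩)).symm
        | cast s => exact (append_castSucc (initial ⟨n, hn⟩ x, x ⟨n, hn⟩) s).symm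
      rw [step (h _), step (h' _), ih]
  have hid : (fun (x : Path d T) (s : Fin T) => x (Fin.castLE le_rfl s)) = id := rfl
  simpa only [hid, Measure.map_id] using key T le_rfl

/-- Append a pair of states to a pair of paths. -/
def appendPair {n : ℕ} (z : (Path d n × Path d n) × (State d × State d)) :
    Path d (n + 1) × Path d (n + 1) :=
  (append (z.1.1, z.2.1), append (z.1.2, z.2.2))

@[fun_prop]
lemma measurable_appendPair {n : ℕ} : Measurable (appendPair (d := d) (n := n)) := by
  unfold appendPair
  fun_prop

/-! ### Laws of pairs of paths generated by pair kernels -/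

variable {K : (n : ℕ) → Kernel (Path d n × Path d n) (State d × State d)}

/-- The law of the pair of paths which moves according to the kernels `K`. -/
noncomputable def pathLaw (K : (n : ℕ) → Kernel (Path d n × Path d n) (State d × State d)) :
    (n : ℕ) → Measure (Path d n × Path d n)
  | 0 => Measure.dirac (0, 0)
  | n + 1 => (pathLaw K n ⊗ₘ K n).map appendPair

instance [∀ n, IsMarkovKernel (K n)] (n : ℕ) : IsProbabilityMeasure (pathLaw K n) := by
  induction n with
  | zero => rw [pathLaw]; infer_instance
  | succ n ih => exact Measure.isProbabilityMeasure_map measurable_appendPair.aemeasurable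

/-- Later steps only append states by Markov kernels, so they leave the law of an earlier segment
unchanged. -/
lemma pathLaw_map_initial_next [∀ n, IsMarkovKernel (K n)] (t : Fin T) :
    (pathLaw K T).map (fun p => ((initial t p.1, initial t p.2), (p.1 t, p.2 t)))
      = pathLaw K t ⊗ₘ K t := by
  induction T with
  | zero => exact t.elim0
  | succ n ih =>
    rw [pathLaw, Measure.map_map (by fun_prop) measurable_appendPair]
    induction t using Fin.lastCases with
    | last =>
      refine Eq.trans (congrArg (Measure.map · _) (funext fun z => ?_)) Measure.map_id
      simp [appendPair]
    | cast t =>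
      refine Eq.trans ?_ (ih t)
      conv_rhs => rw [← Measure.fst_compProd (pathLaw K n) (K n), Measure.fst,
        Measure.map_map (by fun_prop) measurable_fst]
      congr 1
      ext1 z
      simp [appendPair]

lemma pathLaw_map_initial [∀ n, IsMarkovKernel (K n)] (t : Fin T) :
    (pathLaw K T).map (fun p => (initial t p.1, initial t p.2)) = pathLaw K t := by
  rw [← Measure.fst_compProd (pathLaw K t) (K t), ← pathLaw_map_initial_next, Measure.fst,
    Measure.map_map measurable_fst (by fun_prop)]
  rfl

lemma isPairKernel_pathLaw [∀ n, IsMarkovKernel (K n)] (t : Fin T) :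
    IsPairKernel (pathLaw K T) t (K t) := by
  refine ⟨inferInstance, by fun_prop, ?_⟩
  rw [pathLaw_map_initial, pathLaw_map_initial_next]

/-- The hypothesis `h` is causality in abstract form: the image of the next step depends on the past
only through `f`. -/
lemma compProd_map_prodMap {X Y X' Y' : Type*} [MeasurableSpace X] [MeasurableSpace Y]
    [MeasurableSpace X'] [MeasurableSpace Y'] {m : Measure X} [SFinite m] {κ : Kernel X Y}
    [IsSFiniteKernel κ] {η : Kernel X' Y'} [IsSFiniteKernel η] {f : X → X'} {g : Y → Y'}
    (hf : Measurable f) (hg : Measurable g) (h : ∀ x, (κ x).map g = η (f x)) :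
    (m ⊗ₘ κ).map (Prod.map f g) = m.map f ⊗ₘ η := by
  refine Measure.ext_of_lintegral _ fun F hF => ?_
  rw [lintegral_map hF (hf.prodMap hg), Measure.lintegral_compProd (by fun_prop),
    Measure.lintegral_compProd hF, lintegral_map (by fun_prop) hf]
  refine lintegral_congr fun x => ?_
  rw [← h, lintegral_map (by fun_prop) hg]
  rfl

/-- Applied with `φ` either projection, it identifies the kernels of both marginals. -/
lemma isPathKernel_map {π : Measure (Path d T × Path d T)} [IsProbabilityMeasure π] {t : Fin T}
    {κπ : Kernel (Path d (t : ℕ) × Path d (t : ℕ)) (State d × State d)}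
    {κ : Kernel (Path d (t : ℕ)) (State d)} [hκ : IsMarkovKernel κ] (h : IsPairKernel π t κπ)
    {φ : Path d T × Path d T → Path d T} (hφ : Measurable φ)
    {f : Path d (t : ℕ) × Path d (t : ℕ) → Path d (t : ℕ)} (hf : Measurable f)
    {g : State d × State d → State d} (hg : Measurable g)
    (hφf : ∀ p, initial t (φ p) = f (initial t p.1, initial t p.2))
    (hφg : ∀ p, φ p t = g (p.1 t, p.2 t))
    (hK : ∀ p, (κπ p).map g = κ (f p)) : IsPathKernel (π.map φ) t κ := by
  have := h.1
  refine ⟨hκ, by fun_prop, ?_⟩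
  rw [Measure.map_map (by fun_prop) hφ, Measure.map_map (by fun_prop) hφ]
  have h1 : initial (d := d) t ∘ φ = f ∘ fun p => (initial t p.1, initial t p.2) := funext hφf
  rw [h1, ← Measure.map_map hf (by fun_prop), ← compProd_map_prodMap hf hg hK, ← h.2.map_eq,
    Measure.map_map (hf.prodMap hg) (by fun_prop)]
  congr 1
  ext1 p
  simp [hφf, hφg]

/-- Kernels which couple the kernels of `μ` and `ν` glue to a bicausal coupling. -/
lemma isBicausalCoupling_pathLaw [∀ n, IsMarkovKernel (K n)] {μ ν : Measure (Path d T)}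
    [IsProbabilityMeasure μ] [IsProbabilityMeasure ν]
    {κ κ' : (t : Fin T) → Kernel (Path d (t : ℕ)) (State d)}
    (hμ : ∀ t, IsPathKernel μ t (κ t)) (hν : ∀ t, IsPathKernel ν t (κ' t))
    (hK : ∀ (t : Fin T) (p), IsCoupling (K t p) (κ t p.1) (κ' t p.2)) :
    IsBicausalCoupling (pathLaw K T) μ ν := by
  refine ⟨⟨?_, ?_⟩, fun t => ⟨κ t, κ' t, K t, hμ t, hν t, isPairKernel_pathLaw t,
    ae_of_all _ fun p => hK t _⟩⟩
  · have := Measure.isProbabilityMeasure_map (μ := pathLaw K T) measurable_fst.aemeasurable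
    -- The marginal has the same kernels as `μ`, and these determine the law.
    refine eq_of_isPathKernel (κ := κ) (fun t => ?_) hμ
    have := (hμ t).1
    exact isPathKernel_map (isPairKernel_pathLaw t) measurable_fst measurable_fst
      measurable_fst (fun _ => rfl) (fun _ => rfl) fun p => (hK t p).1
  · have := Measure.isProbabilityMeasure_map (μ := pathLaw K T) measurable_snd.aemeasurable
    refine eq_of_isPathKernel (κ := κ') (fun t => ?_) hν
    have := (hν t).1
    exact isPathKernel_map (isPairKernel_pathLaw t) measurable_snd measurable_snd
      measurable_snd (fun _ => rfl) (fun _ => rfl) fun p => (hK t p).2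

/-- `sumDist`, as an extended nonnegative real. -/
noncomputable def sumEDist {n : ℕ} (x y : Path d n) : ℝ≥0∞ := ∑ s, edist (x s) (y s)

lemma ofReal_sumDist {n : ℕ} (x y : Path d n) : ENNReal.ofReal (sumDist x y) = sumEDist x y := by
  rw [sumDist, sumEDist, ENNReal.ofReal_sum_of_nonneg fun _ _ => norm_nonneg _]
  simp only [edist_dist, dist_eq_norm]

lemma measurable_sumEDist {n : ℕ} :
    Measurable fun p : Path d n × Path d n => sumEDist p.1 p.2 := by
  unfold sumEDist
  fun_prop

lemma sumEDist_triangle {n : ℕ} (x y z : Path d n) :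
    sumEDist x z ≤ sumEDist x y + sumEDist y z := by
  rw [sumEDist, sumEDist, sumEDist, ← Finset.sum_add_distrib]
  exact Finset.sum_le_sum fun s _ => edist_triangle _ _ _

lemma lintegral_pathLaw_zero : ∫⁻ p, sumEDist p.1 p.2 ∂(pathLaw K 0) = 0 := by
  simp [sumEDist]

lemma lintegral_pathLaw_succ [∀ n, IsMarkovKernel (K n)] (n : ℕ) :
    ∫⁻ p, sumEDist p.1 p.2 ∂(pathLaw K (n + 1)) = ∫⁻ p, sumEDist p.1 p.2 ∂(pathLaw K n) +
      ∫⁻ p, ∫⁻ z, edist z.1 z.2 ∂(K n p) ∂(pathLaw K n) := by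
  rw [pathLaw, lintegral_map measurable_sumEDist measurable_appendPair,
    Measure.lintegral_compProd (f := fun z => sumEDist (appendPair z).1 (appendPair z).2)
      (measurable_sumEDist.comp measurable_appendPair),
    ← lintegral_add_left measurable_sumEDist]
  refine lintegral_congr fun p => ?_
  simp [sumEDist, Fin.sum_univ_castSucc, appendPair, lintegral_add_left]

/-! ### Kernels of a convolution -/

lemma pi_map_initial_next (m : Measure (State d)) [IsProbabilityMeasure m] (t : Fin T) :
    (Measure.pi fun _ : Fin T => m).map (fun g => (initial t g, g t))
      = (Measure.pi fun _ : Fin (t : ℕ) => m).prod m := by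
  have hi : iIndepFun (fun (i : Fin T) (g : Path d T) => g i) (Measure.pi fun _ : Fin T => m) :=
    iIndepFun_pi (X := fun _ => id) fun _ => aemeasurable_id
  have heval : ∀ i, (Measure.pi fun _ : Fin T => m).map (fun g : Path d T => g i) = m := fun i =>
    (measurePreserving_eval (fun _ : Fin T => m) i).map_eq
  have h1 : (Measure.pi fun _ : Fin T => m).map (initial t)
      = Measure.pi fun _ : Fin (t : ℕ) => m := by
    have := (iIndepFun_iff_map_fun_eq_pi_map fun i => (measurable_pi_apply _).aemeasurable).1
      (hi.precomp (Fin.castLE_injective t.is_lt.le))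
    simp only [heval] at this
    exact this
  have h2 : IndepFun (initial t) (fun g : Path d T => g t) (Measure.pi fun _ : Fin T => m) := by
    have := hi.indepFun_finset (Finset.univ.filter (· < t)) {t} (by simp)
      fun i => measurable_pi_apply i
    exact this.comp
      (φ := fun (x : {s // s ∈ Finset.univ.filter (· < t)} → State d) (s : Fin t) =>
        x ⟨Fin.castLE t.is_lt.le s, by
        simpa using Fin.lt_def.2 s.is_lt⟩)
      (ψ := fun x : ({t} : Finset (Fin T)) → State d => x ⟨t, by simp⟩)
      (measurable_pi_lambda _ fun _ => measurable_pi_apply _)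
      (measurable_pi_apply (⟨t, by simp⟩ : ({t} : Finset (Fin T))))
  rw [(indepFun_iff_map_prod_eq_prod_map_map (by fun_prop)
    (measurable_pi_apply t).aemeasurable).1 h2, h1, heval]

section convolution

variable {X E : Type*} [MeasurableSpace X] [MeasurableSpace E] [AddMonoid X] [Add E]
  [MeasurableAdd₂ X] [MeasurableAdd₂ E]

/-- The joint law of `x + g` and `x`, where `x` and `g` are independent with laws `m` and `n`. -/
noncomputable def signalNoiseLaw (m n : Measure X) : Measure (X × X) :=
  (m.prod n).map fun z => (z.1 + z.2, z.1)

instance (m n : Measure X) [IsProbabilityMeasure m] [IsProbabilityMeasure n] :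
    IsProbabilityMeasure (signalNoiseLaw m n) :=
  Measure.isProbabilityMeasure_map (by fun_prop)

lemma fst_signalNoiseLaw (m n : Measure X) : (signalNoiseLaw m n).fst = m.conv n := by
  rw [signalNoiseLaw, Measure.fst, Measure.map_map (by fun_prop) (by fun_prop)]
  rfl

variable [StandardBorelSpace X] [Nonempty X]

/-- Averaging the posterior over the law of the observation restores the joint law of `(x + g, x)`;
this later turns posterior distances into noise sizes. -/
lemma lintegral_condKernel_signalNoiseLaw (m n : Measure X) [IsProbabilityMeasure m]
    [IsProbabilityMeasure n] {f : X × X → ℝ≥0∞} (hf : Measurable f) :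
    ∫⁻ y, ∫⁻ x, f (y, x) ∂((signalNoiseLaw m n).condKernel y) ∂(m.conv n) =
      ∫⁻ x, ∫⁻ g, f (x + g, x) ∂n ∂m := by
  rw [← fst_signalNoiseLaw, ← Measure.lintegral_compProd hf, Measure.disintegrate, signalNoiseLaw,
    lintegral_map hf (by fun_prop), lintegral_prod _ (by fun_prop)]

/-- The kernel of `a + b` given `x + g`, where `a` moves from `x` according to `κ` and the noises
`g` and `b` are independent of it, with laws `n` and `n₁`. -/
noncomputable def noisyKernel (m n : Measure X) [IsFiniteMeasure (signalNoiseLaw m n)]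
    (κ : Kernel X E) (n₁ : Measure E) : Kernel X E :=
  ((κ ×ₖ Kernel.const X n₁).map fun z => z.1 + z.2) ∘ₖ (signalNoiseLaw m n).condKernel

variable (m n : Measure X) [IsProbabilityMeasure m] [IsProbabilityMeasure n] (κ : Kernel X E)
  [IsMarkovKernel κ] (n₁ : Measure E) [IsProbabilityMeasure n₁]

instance : IsMarkovKernel (noisyKernel m n κ n₁) := by
  have := Kernel.IsMarkovKernel.map (κ ×ₖ Kernel.const X n₁)
    (f := fun z : E × E => z.1 + z.2) (by fun_prop)
  rw [noisyKernel]
  infer_instance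

lemma lintegral_noisyKernel (y : X) {f : E → ℝ≥0∞} (hf : Measurable f) :
    ∫⁻ z, f z ∂(noisyKernel m n κ n₁ y) =
      ∫⁻ x, ∫⁻ a, ∫⁻ b, f (a + b) ∂n₁ ∂(κ x) ∂((signalNoiseLaw m n).condKernel y) := by
  rw [noisyKernel, Kernel.lintegral_comp _ _ _ hf]
  refine lintegral_congr fun x => ?_
  rw [Kernel.lintegral_map _ (by fun_prop) _ hf, Kernel.lintegral_prod _ _ _ (by fun_prop)]
  simp

/-- Given `x`, the next state is independent of the noise `g`. Observing `x + g` therefore changes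
only the law of `x`, to the posterior, and not the move from `x`. -/
lemma map_add_compProd_prod :
    ((m ⊗ₘ κ).prod (n.prod n₁)).map (fun z => (z.1.1 + z.2.1, z.1.2 + z.2.2)) =
      m.conv n ⊗ₘ noisyKernel m n κ n₁ := by
  refine Measure.ext_of_lintegral _ fun f hf => ?_
  rw [lintegral_map hf (by fun_prop), lintegral_prod _ (by fun_prop),
    Measure.lintegral_compProd (by fun_prop), Measure.lintegral_compProd hf]
  have hlam : ∀ y, ∫⁻ b, f (y, b) ∂(noisyKernel m n κ n₁ y) = ∫⁻ x, ∫⁻ a, ∫⁻ b, f (y, a + b) ∂n₁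
      ∂(κ x) ∂((signalNoiseLaw m n).condKernel y) := fun y =>
    lintegral_noisyKernel m n κ n₁ y (hf.comp measurable_prodMk_left)
  simp only [hlam]
  have hF : Measurable fun z : X × X => ∫⁻ a, ∫⁻ b, f (z.1, a + b) ∂n₁ ∂(κ z.2) := by
    refine Measurable.lintegral_kernel_prod_right' (κ := κ.comap Prod.snd measurable_snd)
      (f := fun w : (X × X) × E => ∫⁻ b, f (w.1.1, w.2 + b) ∂n₁) ?_
    fun_prop
  rw [lintegral_condKernel_signalNoiseLaw m n hF]
  refine lintegral_congr fun x => ?_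
  refine Eq.trans (lintegral_congr fun a => lintegral_prod _ (by fun_prop)) ?_
  -- This exchange is the conditional independence of `a` and `g` given `x`.
  exact lintegral_lintegral_swap (f := fun a g => ∫⁻ b, f (x + g, a + b) ∂n₁) (by fun_prop)

end convolution

/-- Noise that is independent across time splits into the noise on the past and that on the next
state, so `map_add_compProd_prod` applies. The law of the past comes along because the kernel is a
conditional law with respect to it. -/
lemma isPathKernel_conv {μ : Measure (Path d T)} [IsProbabilityMeasure μ] {m : Measure (State d)}
    [IsProbabilityMeasure m] {t : Fin T} {κ : Kernel (Path d (t : ℕ)) (State d)}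
    [IsMarkovKernel κ] (h : IsPathKernel μ t κ) [IsProbabilityMeasure (μ.map (initial t))] :
    (μ.conv (Measure.pi fun _ => m)).map (initial t)
        = (μ.map (initial t)).conv (Measure.pi fun _ => m) ∧
      IsPathKernel (μ.conv (Measure.pi fun _ => m)) t
        (noisyKernel (μ.map (initial t)) (Measure.pi fun _ => m) κ m) := by
  have key : (μ.conv (Measure.pi fun _ => m)).map (fun x => (initial t x, x t)) =
      (μ.map (initial t)).conv (Measure.pi fun _ => m) ⊗ₘ
        noisyKernel (μ.map (initial t)) (Measure.pi fun _ => m) κ m := by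
    rw [← map_add_compProd_prod, ← h.2.map_eq, ← pi_map_initial_next, Measure.conv,
      Measure.map_map (by fun_prop) (by fun_prop), Measure.map_prod_map _ _ (by fun_prop)
      (by fun_prop), Measure.map_map (by fun_prop) (by fun_prop)]
    rfl
  have h1 : (μ.conv (Measure.pi fun _ => m)).map (initial t)
        = (μ.map (initial t)).conv (Measure.pi fun _ => m) := by
    have := congrArg Measure.fst key
    rwa [Measure.fst_compProd, Measure.fst, Measure.map_map measurable_fst (by fun_prop)] at this
  refine ⟨h1, inferInstance, by fun_prop, ?_⟩
  rw [key, h1]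

/-! ### Coupling a law with its convolution -/

section noisyCoupling

variable {X E : Type*} [MeasurableSpace X] [MeasurableSpace E] [AddMonoid X] [Add E]
  [MeasurableAdd₂ X] [MeasurableAdd₂ E] [StandardBorelSpace X] [Nonempty X]

/-- At `(x', y)`, sample `x` given `x + g = y`, couple the next states after `x'` and `x` by `γ`,
and add noise to the second one. -/
noncomputable def noisyCoupling (m n : Measure X) [IsFiniteMeasure (signalNoiseLaw m n)]
    (γ : Kernel (X × X) (E × E)) (n₁ : Measure E) : Kernel (X × X) (E × E) :=
  ((γ ×ₖ Kernel.const (X × X) n₁).map fun z => (z.1.1, z.1.2 + z.2)) ∘ₖ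
    (Kernel.id ∥ₖ (signalNoiseLaw m n).condKernel)

variable (m n : Measure X) [IsProbabilityMeasure m] [IsProbabilityMeasure n]
  (γ : Kernel (X × X) (E × E)) [IsMarkovKernel γ] (n₁ : Measure E) [IsProbabilityMeasure n₁]

instance : IsMarkovKernel (noisyCoupling m n γ n₁) := by
  have := Kernel.IsMarkovKernel.map (γ ×ₖ Kernel.const (X × X) n₁)
    (f := fun z : (E × E) × E => (z.1.1, z.1.2 + z.2)) (by fun_prop)
  rw [noisyCoupling]
  infer_instance

lemma lintegral_noisyCoupling (p : X × X) {f : E × E → ℝ≥0∞} (hf : Measurable f) :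
    ∫⁻ z, f z ∂(noisyCoupling m n γ n₁ p) =
      ∫⁻ x, ∫⁻ z, ∫⁻ b, f (z.1, z.2 + b) ∂n₁ ∂(γ (p.1, x))
        ∂((signalNoiseLaw m n).condKernel p.2) := by
  rw [noisyCoupling, Kernel.lintegral_comp _ _ _ hf, Kernel.parallelComp_apply, Kernel.id_apply,
    lintegral_prod _ (Measurable.aemeasurable (by fun_prop)), lintegral_dirac']
  · refine lintegral_congr fun x => ?_
    rw [Kernel.lintegral_map _ (by fun_prop) _ hf, Kernel.lintegral_prod _ _ _ (by fun_prop)]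
    simp
  · fun_prop

/-- The first marginal of `γ` at `(p.1, x)` is `κ p.1` whatever `x` is, so sampling `x` leaves it
intact; the second, averaged over the posterior at `p.2` and with noise added, is `noisyKernel`. -/
lemma isCoupling_noisyCoupling {κ : Kernel X E} [IsMarkovKernel κ]
    (hγ : ∀ p, IsCoupling (γ p) (κ p.1) (κ p.2)) (p : X × X) :
    IsCoupling (noisyCoupling m n γ n₁ p) (κ p.1) (noisyKernel m n κ n₁ p.2) := by
  constructor
  · refine Measure.ext_of_lintegral _ fun f hf => ?_
    rw [lintegral_map hf measurable_fst, lintegral_noisyCoupling m n γ n₁ p (by fun_prop)]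
    simp [(hγ _).lintegral_fst hf]
  · refine Measure.ext_of_lintegral _ fun f hf => ?_
    rw [lintegral_map hf measurable_snd, lintegral_noisyCoupling m n γ n₁ p (by fun_prop),
      lintegral_noisyKernel m n κ n₁ _ hf]
    refine lintegral_congr fun x => ?_
    exact (hγ (p.1, x)).lintegral_snd (f := fun a => ∫⁻ b, f (a + b) ∂n₁) (by fun_prop)

end noisyCoupling

/-! ### Costs -/

lemma exists_isCoupling_lintegral_le {μ ν : Measure (State d)} {c ε : ℝ≥0∞} (h : W₁ μ ν ≤ c)
    (hc : c ≠ ∞) (hε : ε ≠ 0) :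
    ∃ ρ, IsCoupling ρ μ ν ∧ ∫⁻ z, edist z.1 z.2 ∂ρ ≤ c + ε := by
  have h1 : W₁ μ ν < c + ε := h.trans_lt (ENNReal.lt_add_right hc hε)
  simp only [W₁, iInf_lt_iff] at h1
  obtain ⟨ρ, hρ, hlt⟩ := h1
  refine ⟨ρ, hρ, ?_⟩
  simpa only [edist_dist, dist_eq_norm] using hlt.le

/-- A Lipschitz version of the kernel of a law with finite first moment has finite first moments,
everywhere. -/
lemma lintegral_kernel_edist_ne_top {μ : Measure (Path d T)} [IsProbabilityMeasure μ]
    (hμ : FiniteFirstMoment μ) {t : Fin T} {κ : Kernel (Path d (t : ℕ)) (State d)}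
    (hκ : IsPathKernel μ t κ) {L : ℝ}
    (hL : ∀ x y, W₁ (κ x) (κ y) ≤ ENNReal.ofReal (L * sumDist x y)) (x : Path d (t : ℕ)) :
    ∫⁻ z, edist z 0 ∂(κ x) ≠ ∞ := by
  have := hκ.1
  have hm := Measure.isProbabilityMeasure_map (μ := μ) (measurable_initial t).aemeasurable
  have hx : ∫⁻ x, edist (x t) 0 ∂μ ≠ ∞ := by
    refine ne_top_of_le_ne_top hμ.lintegral_lt_top.ne (lintegral_mono fun x => ?_)
    rw [ofReal_sumDist, sumEDist]
    exact Finset.single_le_sum (f := fun s => edist (x s) ((0 : Path d T) s))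
      (fun _ _ => zero_le) (Finset.mem_univ t)
  have h1 : ∫⁻ x, edist (x t) 0 ∂μ = ∫⁻ x, ∫⁻ z, edist z 0 ∂(κ x) ∂(μ.map (initial t)) := by
    rw [← Measure.lintegral_compProd (f := fun w : Path d (t : ℕ) × State d => edist w.2 0)
      (by fun_prop), ← hκ.2.map_eq, lintegral_map (by fun_prop) (by fun_prop)]
  rw [h1] at hx
  -- The moment is finite almost everywhere, hence at some `x₀`, and the Lipschitz bound carries it
  -- from there to every `x`.
  obtain ⟨x₀, hx₀⟩ := (ae_lt_top (by fun_prop) hx).exists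
  obtain ⟨ρ, hρ, hρc⟩ := exists_isCoupling_lintegral_le (hL x x₀) ENNReal.ofReal_ne_top one_ne_zero
  rw [← hρ.lintegral_fst (f := fun z => edist z 0) (by fun_prop)]
  refine ne_top_of_le_ne_top (b := ∫⁻ z, edist z.1 z.2 ∂ρ + ∫⁻ z, edist z.2 0 ∂ρ) ?_ ?_
  · rw [hρ.lintegral_snd (f := fun z => edist z 0) (by fun_prop)]
    exact ENNReal.add_ne_top.2 ⟨ne_top_of_le_ne_top (by simp) hρc, hx₀.ne⟩
  · rw [← lintegral_add_left (by fun_prop)]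
    exact lintegral_mono fun z => edist_triangle _ _ _

lemma lintegral_sumEDist_noise (m : Measure (State d)) [IsProbabilityMeasure m] {n : ℕ}
    (x : Path d n) : ∫⁻ g, sumEDist (x + g) x ∂(Measure.pi fun _ : Fin n => m)
      = n * ∫⁻ z, ‖z‖ₑ ∂m := by
  simp only [sumEDist, Pi.add_apply, edist_eq_enorm_sub, add_sub_cancel_left]
  rw [lintegral_finsetSum _ (by fun_prop)]
  have h : ∀ s : Fin n, ∫⁻ g : Path d n, ‖g s‖ₑ ∂(Measure.pi fun _ : Fin n => m)
      = ∫⁻ z, ‖z‖ₑ ∂m := fun s => by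
    rw [← (measurePreserving_eval (fun _ : Fin n => m) s).map_eq,
      lintegral_map (by fun_prop) (by fun_prop),
      (measurePreserving_eval (fun _ : Fin n => m) s).map_eq]
  simp [h]

section step

variable (m : Measure (State d)) [IsProbabilityMeasure m]

lemma lintegral_noisyCoupling_edist_le {X : Type*} [MeasurableSpace X] [AddMonoid X]
    [MeasurableAdd₂ X] [StandardBorelSpace X] [Nonempty X] (μ n : Measure X)
    [IsProbabilityMeasure μ] [IsProbabilityMeasure n]
    (γ : Kernel (X × X) (State d × State d)) [IsMarkovKernel γ] {c : X × X → ℝ≥0∞}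
    (hγ : ∀ p, ∫⁻ z, edist z.1 z.2 ∂(γ p) ≤ c p) (p : X × X) :
    ∫⁻ z, edist z.1 z.2 ∂(noisyCoupling μ n γ m p) ≤
      ∫⁻ x, c (p.1, x) ∂((signalNoiseLaw μ n).condKernel p.2) + ∫⁻ z, ‖z‖ₑ ∂m := by
  rw [lintegral_noisyCoupling μ n γ m p (by fun_prop)]
  calc _ ≤ ∫⁻ x, ∫⁻ z, ∫⁻ b, (edist z.1 z.2 + ‖b‖ₑ) ∂m ∂(γ (p.1, x))
        ∂((signalNoiseLaw μ n).condKernel p.2) := by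
        gcongr with x z b
        refine (edist_triangle _ z.2 _).trans ?_
        simp [edist_eq_enorm_sub]
    _ = ∫⁻ x, (∫⁻ z, edist z.1 z.2 ∂(γ (p.1, x)) + ∫⁻ z, ‖z‖ₑ ∂m)
        ∂((signalNoiseLaw μ n).condKernel p.2) := by
        simp [lintegral_add_left, lintegral_add_right]
    _ ≤ ∫⁻ x, (c (p.1, x) + ∫⁻ z, ‖z‖ₑ ∂m) ∂((signalNoiseLaw μ n).condKernel p.2) := by
        gcongr with x
        exact hγ _
    _ = _ := by simp [lintegral_add_right]

/-- The cost of one step of the coupling. -/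
lemma lintegral_lintegral_noisyCoupling_le {n : ℕ} {μ : Measure (Path d n)}
    [IsProbabilityMeasure μ] {γ : Kernel (Path d n × Path d n) (State d × State d)}
    [IsMarkovKernel γ] {l ε : ℝ≥0∞}
    (hγ : ∀ p, ∫⁻ z, edist z.1 z.2 ∂(γ p) ≤ l * sumEDist p.1 p.2 + ε)
    {π : Measure (Path d n × Path d n)} [IsProbabilityMeasure π]
    (hπ : π.map Prod.snd = μ.conv (Measure.pi fun _ => m)) :
    ∫⁻ p, ∫⁻ z, edist z.1 z.2 ∂(noisyCoupling μ (Measure.pi fun _ => m) γ m p) ∂π ≤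
      l * (∫⁻ p, sumEDist p.1 p.2 ∂π + n * ∫⁻ z, ‖z‖ₑ ∂m) + ε + ∫⁻ z, ‖z‖ₑ ∂m := by
  set ψ := (signalNoiseLaw μ (Measure.pi fun _ : Fin n => m)).condKernel
  have hsum : ∀ x : Path d n, Measurable fun y => sumEDist x y := fun x =>
    measurable_sumEDist.comp (f := fun y => (x, y)) measurable_prodMk_left
  -- The integrand depends on `p.2` alone, so only the second marginal of `π` matters and not how
  -- the coupling was built.
  have hpost : ∫⁻ p, ∫⁻ x, sumEDist p.2 x ∂(ψ p.2) ∂π = n * ∫⁻ z, ‖z‖ₑ ∂m := by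
    have hmeas : Measurable fun y : Path d n => ∫⁻ x, sumEDist y x ∂(ψ y) :=
      Measurable.lintegral_kernel_prod_right' (κ := ψ)
        (f := fun p : Path d n × Path d n => sumEDist p.1 p.2) measurable_sumEDist
    refine (lintegral_map hmeas measurable_snd).symm.trans ?_
    rw [hπ, lintegral_condKernel_signalNoiseLaw _ _ measurable_sumEDist]
    simp [lintegral_sumEDist_noise]
  have hstep : ∀ p : Path d n × Path d n,
      ∫⁻ z, edist z.1 z.2 ∂(noisyCoupling μ (Measure.pi fun _ => m) γ m p) ≤
        l * (sumEDist p.1 p.2 + ∫⁻ x, sumEDist p.2 x ∂(ψ p.2)) + (ε + ∫⁻ z, ‖z‖ₑ ∂m) := by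
    intro p
    refine (lintegral_noisyCoupling_edist_le m μ _ γ hγ p).trans ?_
    rw [← add_assoc]
    gcongr
    calc _ ≤ ∫⁻ x, (l * (sumEDist p.1 p.2 + sumEDist p.2 x) + ε) ∂(ψ p.2) := by
          gcongr with x
          exact sumEDist_triangle _ _ _
      _ = _ := by
          rw [lintegral_add_right _ measurable_const, lintegral_const_mul _ (by fun_prop),
            lintegral_add_left measurable_const]
          simp
  calc _ ≤ ∫⁻ p, (l * (sumEDist p.1 p.2 + ∫⁻ x, sumEDist p.2 x ∂(ψ p.2))
        + (ε + ∫⁻ z, ‖z‖ₑ ∂m)) ∂π := lintegral_mono hstep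
    _ = _ := by
        have hmeas : Measurable fun p : Path d n × Path d n => ∫⁻ x, sumEDist p.2 x ∂(ψ p.2) :=
          (Measurable.lintegral_kernel_prod_right' (κ := ψ)
            (f := fun p : Path d n × Path d n => sumEDist p.1 p.2)
            measurable_sumEDist).comp measurable_snd
        rw [lintegral_add_right _ measurable_const,
          lintegral_const_mul _ (f := fun p : Path d n × Path d n =>
            sumEDist p.1 p.2 + ∫⁻ x, sumEDist p.2 x ∂(ψ p.2)) (measurable_sumEDist.add hmeas),
          lintegral_add_left measurable_sumEDist, hpost]
        simp [add_assoc]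

end step

/-! ### The constant and the conclusion -/

lemma lintegral_enorm_stdGaussian_ne_top :
    ∫⁻ z, ‖z‖ₑ ∂(stdGaussian (State d)) ≠ ∞ :=
  (IsGaussian.integrable_id (μ := stdGaussian (State d))).hasFiniteIntegral.ne

lemma lintegral_enorm_map_smul (m : Measure (State d)) {σ : ℝ} (hσ : 0 ≤ σ) :
    ∫⁻ z, ‖z‖ₑ ∂(m.map fun z => σ • z) = ENNReal.ofReal σ * ∫⁻ z, ‖z‖ₑ ∂m := by
  rw [lintegral_map (by fun_prop) (by fun_prop), ← lintegral_const_mul _ (by fun_prop)]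
  simp [enorm_smul, Real.enorm_of_nonneg hσ]

/-- The constant in the stability estimate for `n` steps, where `c` is the first absolute moment of
the standard Gaussian measure. -/
noncomputable def stabilityConst (l c : ℝ≥0∞) : ℕ → ℝ≥0∞
  | 0 => 0
  | n + 1 => stabilityConst l c n + (l * (stabilityConst l c n + n * c) + 1 + c)

lemma stabilityConst_ne_top {l c : ℝ≥0∞} (hl : l ≠ ∞) (hc : c ≠ ∞) (n : ℕ) :
    stabilityConst l c n ≠ ∞ := by
  induction n with
  | zero => simp [stabilityConst]
  | succ n ih =>
    simp only [stabilityConst]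
    finiteness

/-- The next states of a law with Lipschitz kernels can be coupled, at a cost which is Lipschitz up
to an arbitrarily small error. -/
lemma exists_kernel_isCoupling_self {μ : Measure (Path d T)} [IsProbabilityMeasure μ]
    (hμ : FiniteFirstMoment μ) {t : Fin T} {κ : Kernel (Path d (t : ℕ)) (State d)}
    (hκ : IsPathKernel μ t κ) {L : ℝ} (hL0 : 0 ≤ L)
    (hL : ∀ x y, W₁ (κ x) (κ y) ≤ ENNReal.ofReal (L * sumDist x y)) {ε : ℝ≥0∞} (hε : ε ≠ 0) :
    ∃ γ : Kernel (Path d (t : ℕ) × Path d (t : ℕ)) (State d × State d), IsMarkovKernel γ ∧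
      ∀ p, IsCoupling (γ p) (κ p.1) (κ p.2) ∧
        ∫⁻ z, edist z.1 z.2 ∂(γ p) ≤ ENNReal.ofReal L * sumEDist p.1 p.2 + ε := by
  have := hκ.1
  have hmom := lintegral_kernel_edist_ne_top hμ hκ hL
  have hε2 : ε / 2 ≠ 0 := by simpa using hε
  obtain ⟨γ, hγ, h⟩ := exists_kernel_isCoupling
    (A := Path d (t : ℕ) × Path d (t : ℕ)) (κ.comap Prod.fst measurable_fst)
    (κ.comap Prod.snd measurable_snd) (0 : State d) (fun p => hmom p.1) (fun p => hmom p.2)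
    (c := fun p => ENNReal.ofReal L * sumEDist p.1 p.2 + ε / 2)
    ((measurable_sumEDist.const_mul _).add_const _) (fun p => by
      refine exists_isCoupling_lintegral_le ?_ ?_ hε2
      · rw [← ofReal_sumDist, ← ENNReal.ofReal_mul hL0]
        exact hL _ _
      · rw [← ofReal_sumDist]
        finiteness) hε2
  refine ⟨γ, hγ, fun p => ⟨(h p).1, (h p).2.trans_eq ?_⟩⟩
  rw [add_assoc, ENNReal.add_halves]

theorem AW₁_conv_le {L : ℝ} (hL : 0 ≤ L) {μ : Measure (Path d T)} [IsProbabilityMeasure μ]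
    (hμ : FiniteFirstMoment μ) (hμL : HasLipschitzKernels L μ) {σ : ℝ} (hσ : 0 < σ) :
    AW₁ μ (μ.conv (gaussianNoise d T σ)) ≤
      stabilityConst (ENNReal.ofReal L) (∫⁻ z, ‖z‖ₑ ∂(stdGaussian (State d))) T
        * ENNReal.ofReal σ := by
  set c := ∫⁻ z, ‖z‖ₑ ∂(stdGaussian (State d))
  set l := ENNReal.ofReal L
  set s := ENNReal.ofReal σ
  set m := (stdGaussian (State d)).map fun z => σ • z
  have hmc : ∫⁻ z, ‖z‖ₑ ∂m = s * c := lintegral_enorm_map_smul _ hσ.le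
  have : IsProbabilityMeasure m := Measure.isProbabilityMeasure_map (by fun_prop)
  have : gaussianNoise d T σ = Measure.pi fun _ => m := rfl
  rw [this]
  have hinit : ∀ t : Fin T, IsProbabilityMeasure (μ.map (initial t)) := fun t =>
    Measure.isProbabilityMeasure_map (by fun_prop)
  choose κ hκ hκL using hμL
  have hκM : ∀ t, IsMarkovKernel (κ t) := fun t => (hκ t).1
  -- The selection error is taken to be `σ`, which keeps the bound linear in `σ` and is the source
  -- of the summand `1` in `stabilityConst`.
  choose γ hγM hγ using fun t : Fin T => exists_kernel_isCoupling_self hμ (hκ t) hL (hκL t)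
    (ENNReal.ofReal_pos.2 hσ).ne'
  -- `pathLaw` needs a kernel at every time; from `T` on it is an arbitrary one that plays no role.
  have hext : ∀ n : ℕ, ∃ K : Kernel (Path d n × Path d n) (State d × State d), IsMarkovKernel K ∧
      ∀ h : n < T, K = noisyCoupling (μ.map (initial ⟨n, h⟩)) (Measure.pi fun _ : Fin n => m)
        (γ ⟨n, h⟩) m := by
    intro n
    by_cases h : n < T
    · exact ⟨noisyCoupling (μ.map (initial ⟨n, h⟩)) (Measure.pi fun _ : Fin n => m)
        (γ ⟨n, h⟩) m, inferInstance, fun _ => rfl⟩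
    · exact ⟨Kernel.const _ (Measure.dirac 0), inferInstance, fun h' => absurd h' h⟩
  choose K hKM hK using hext
  have hbc : IsBicausalCoupling (pathLaw K T) μ (μ.conv (Measure.pi fun _ => m)) :=
    isBicausalCoupling_pathLaw hκ (fun t => (isPathKernel_conv (hκ t)).2) fun t p => by
      rw [hK t t.is_lt]
      exact isCoupling_noisyCoupling _ _ _ _ (fun p => (hγ t p).1) p
  -- Projecting the full coupling to time `t` shows that the noisy past has the convolved law, as
  -- the estimate of one step requires.
  have hsnd : ∀ t : Fin T, (pathLaw K t).map Prod.snd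
      = (μ.map (initial t)).conv (Measure.pi fun _ => m) := fun t => by
    rw [← (isPathKernel_conv (m := m) (hκ t)).1, ← hbc.1.2, ← pathLaw_map_initial t,
      Measure.map_map measurable_snd (by fun_prop), Measure.map_map (by fun_prop) measurable_snd]
    rfl
  have hcost : ∀ n ≤ T, ∫⁻ p, sumEDist p.1 p.2 ∂(pathLaw K n) ≤ stabilityConst l c n * s := by
    intro n
    induction n with
    | zero => intro _; rw [lintegral_pathLaw_zero]; exact zero_le
    | succ n ih =>
      intro hn
      have ih := ih (n.le_succ.trans hn)
      have hs := lintegral_lintegral_noisyCoupling_le m (fun p => (hγ ⟨n, hn⟩ p).2)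
        (hsnd ⟨n, hn⟩)
      rw [lintegral_pathLaw_succ, hK n hn, stabilityConst]
      refine (add_le_add ih hs).trans ?_
      rw [hmc]
      grw [ih]
      exact le_of_eq (by ring)
  refine (iInf₂_le (pathLaw K T) hbc).trans ?_
  simp only [ofReal_sumDist]
  exact hcost T le_rfl

end AdaptedTransport

theorem theorem5p1 (d T : ℕ) (hd : 1 ≤ d) (hT : 1 ≤ T) (L : ℝ) (hL : 0 < L) :
    ∃ C : ℝ, 0 < C ∧
      ∀ μ : Measure (AdaptedTransport.Path d T), IsProbabilityMeasure μ →
        AdaptedTransport.FiniteFirstMoment μ → AdaptedTransport.HasLipschitzKernels L μ →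
        ∀ σ : ℝ, 0 < σ →
          AdaptedTransport.AW₁ μ (μ.conv (AdaptedTransport.gaussianNoise d T σ))
            ≤ ENNReal.ofReal (C * σ) := by
  set B := AdaptedTransport.stabilityConst (ENNReal.ofReal L)
    (∫⁻ z, ‖z‖ₑ ∂(stdGaussian (AdaptedTransport.State d))) T
  have hB : B ≠ ∞ := AdaptedTransport.stabilityConst_ne_top ENNReal.ofReal_ne_top
    AdaptedTransport.lintegral_enorm_stdGaussian_ne_top T
  -- The added `1` only makes positivity of the constant immediate.
  refine ⟨B.toReal + 1, by positivity, fun μ hμ hμ1 hμL σ hσ =>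
    (AdaptedTransport.AW₁_conv_le hL.le hμ1 hμL hσ).trans ?_⟩
  rw [ENNReal.ofReal_mul (by positivity)]
  gcongr
  exact ENNReal.le_ofReal_iff_toReal_le hB (by positivity) |>.2 (by linarith)
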